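/- Let $d\in\{2,3\}$ and $k\ge 1$. Let $\mathcal T_h$ be a conforming simplicial triangulation of a bounded open set $\Omega\subset\mathbb R^d$ into open simplices $T$ that is shape regular with constant $\sigma$, i.e. every $T\in\mathcal T_h$ contains a ball of diameter $\rho$ with $\operatorname{diam}T\le\sigma\rho$. Let $\Omega^-$ be open with $\overline{\Omega^-}\subset\Omega$, let $\Omega^+=\Omega\setminus\overline{\Omega^-}$, and let $\Gamma=\partial\Omega^-$ be the interface. Set $\mathcal T_h^\pm=\{T\in\mathcal T_h: T\cap\Omega^\pm\ne\emptyset\}$ and $\Omega_h^\pm=\operatorname{int}\bigcup_{T\in\mathcal T_h^\pm}\overline T$. Let $V_h^\pm$ be the space of pairs $\mathbf v=(\mathbf v^-,\mathbf v^+)$ of vector fields $\mathbf v^-\in C(\Omega_h^-)^d$, $\mathbf v^+\in C(\Omega_h^+)^d$ whose restrictions to each $T\in\mathcal T_h^-$, respectively $T\in\mathcal T_h^+$, are polynomial of degree at most $k+1$ in every component. Let $\mathcal E_h^{\Gamma,\pm}$ be the set of facets $e$ that are the common facet of two different elements $T_1,T_2\in\mathcal T_h^\pm$ with $T_1\cap\Gamma\neq\emptyset$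 or $T_2\cap\Gamma\ne\emptyset$; for such $e$ let $h_e$ be its diameter and let $\omega_e$ be the union of the elements of $\mathcal T_h$ that share $e$. For $\mu_\pm>0$ and parameters $\gamma^\pm_{\mathbf u}$ put $$a_p(\mathbf u,\mathbf v)=\mu_-\mathbf J_h^-(\mathbf u^-,\mathbf v^-)+\mu_+\mathbf J_h^+(\mathbf u^+,\mathbf v^+),\qquad \mathbf J_h^\pm(\mathbf u,\mathbf v)=\gamma^\pm_{\mathbf u}\sum_{e\in\mathcal E_h^{\Gamma,\pm}}\frac1{h_e^2}\int_{\omega_e}(\mathbf u_1^e-\mathbf u_2^e)\cdot(\mathbf v_1^e-\mathbf v_2^e)\,dx,$$ where $\mathbf u_i^e$ is the canonical polynomial extension of $\mathbf u|_{T_i}$ from $T_i$ to $\mathbb R^d$. Let $\mathbf D(\mathbf v)=\frac12(\nabla\mathbf v+(\nabla\mathbf v)^T)$. Then $$a_p(\mathbf v_h,\mathbf v_h)\le C\left(\mu_-\|\mathbf D(\mathbf v_h^-)\|^2_{L^2(\Omega_h^-)}+\mu_+\|\mathbf D(\mathbf v_h^+)\|^2_{L^2(\Omega_h^+)}\right)\qquad\text{for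 all }\mathbf v_h\in V_h^\pm,$$ with a constant $C>0$ that depends only on $d$, $k$, $\sigma$ and $\gamma^\pm_{\mathbf u}$; in particular $C$ is independent of $\mu_\pm$, of the mesh size $h$, and of the position of $\Gamma$ in the background mesh. -/

import Mathlib

open MeasureTheory

noncomputable section

namespace TwoPhaseStokes

/-- The Euclidean space `ℝ^d`. -/
abbrev Space (d : ℕ) : Type := EuclideanSpace ℝ (Fin d)

/-- The closed simplex `T̄` spanned by a finite set of vertices. -/
def closedSimplex {d : ℕ} (s : Finset (Space d)) : Set (Space d) :=
  convexHull ℝ (s : Set (Space d))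

/-- The open simplex `T` (elements are open sets). -/
def openSimplex {d : ℕ} (s : Finset (Space d)) : Set (Space d) :=
  interior (closedSimplex s)

/-- The diameter of an element (`h_T`) or of a facet (`h_e`). -/
def simplexDiam {d : ℕ} (s : Finset (Space d)) : ℝ :=
  Metric.diam (closedSimplex s)

/-- A (finite, conforming) simplicial triangulation `𝒯_h` of `Ω ⊆ ℝ^d`. Simplices are given by
their vertex sets. -/
structure Triangulation {d : ℕ} (Ω : Set (Space d)) where
  /-- the simplicial complex of all elements and of all their subsimplices -/
  complex : Geometry.SimplicialComplex ℝ (Space d)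
  finite : complex.faces.Finite
  /-- every simplex is a subsimplex of a `d`-dimensional one -/
  pure : ∀ s ∈ complex.faces, ∃ t ∈ complex.faces, s ⊆ t ∧ t.card = d + 1
  /-- the closed elements cover exactly `Ω̄` -/
  space_eq : complex.space = closure Ω

variable {d : ℕ} {Ω : Set (Space d)}

open Classical in
/-- The set of elements of `𝒯_h`: the `d`-dimensional simplices. -/
def Triangulation.elements (𝒯 : Triangulation Ω) : Finset (Finset (Space d)) :=
  𝒯.finite.toFinset.filter fun s => s.card = d + 1

/-- Shape regularity with constant `σ`: every element contains a ball of some diameter `2 r`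
with `h_T ≤ σ * (2 r)`. -/
def Triangulation.ShapeRegular (𝒯 : Triangulation Ω) (σ : ℝ) : Prop :=
  ∀ s ∈ 𝒯.elements, ∃ (x : Space d) (r : ℝ), 0 < r ∧
    Metric.closedBall x r ⊆ closedSimplex s ∧ simplexDiam s ≤ σ * (2 * r)

open Classical in
/-- The elements that meet a phase `ω` (`ω = Ω⁻` or `ω = Ω⁺`):
`𝒯_h^± = {T ∈ 𝒯_h : T ∩ Ω^± ≠ ∅}`. -/
def Triangulation.phaseElements (𝒯 : Triangulation Ω) (ω : Set (Space d)) :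
    Finset (Finset (Space d)) :=
  𝒯.elements.filter fun s => (openSimplex s ∩ ω).Nonempty

/-- The extended domain `Ω_h^± = int (⋃_{T ∈ 𝒯_h^±} T̄)`. -/
def Triangulation.extendedDomain (𝒯 : Triangulation Ω) (ω : Set (Space d)) : Set (Space d) :=
  interior (⋃ s ∈ 𝒯.phaseElements ω, closedSimplex s)

open Classical in
/-- `e` is the common facet of the two different elements `s, t ∈ 𝒯_h^±`, at least one of which is
cut by the interface `Γ`. Since the triangulation is conforming, `∂T₁ ∩ ∂T₂` is the simplex
spanned by the common vertices; it is a facet if there are `d` of them. -/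
def Triangulation.IsGhostFacet (𝒯 : Triangulation Ω) (ω Γ : Set (Space d))
    (e s t : Finset (Space d)) : Prop :=
  s ∈ 𝒯.phaseElements ω ∧ t ∈ 𝒯.phaseElements ω ∧ s ≠ t ∧ e = s ∩ t ∧ e.card = d ∧
    ((openSimplex s ∩ Γ).Nonempty ∨ (openSimplex t ∩ Γ).Nonempty)

open Classical in
/-- The set of facets `ℰ_h^{Γ,±}`. -/
def Triangulation.ghostFacets (𝒯 : Triangulation Ω) (ω Γ : Set (Space d)) :
    Finset (Finset (Space d)) :=
  𝒯.finite.toFinset.filter fun e => ∃ s t, 𝒯.IsGhostFacet ω Γ e s t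

/-- The facet patch `ω_e`, made of all elements of `𝒯_h` that share the facet `e`. -/
def Triangulation.patch (𝒯 : Triangulation Ω) (e : Finset (Space d)) : Set (Space d) :=
  ⋃ s ∈ {s | s ∈ 𝒯.elements ∧ e ⊆ s}, closedSimplex s

/-- The vector field on `ℝ^d` with polynomial components `P`. -/
def polyField (P : Fin d → MvPolynomial (Fin d) ℝ) (x : Space d) : Space d :=
  WithLp.toLp 2 fun i => MvPolynomial.eval (fun j => x j) (P i)

/-- The velocity space `V_h^± = {u ∈ C(Ω_h^±)^d : u|_T ∈ P_m(T)^d for all T ∈ 𝒯_h^±}`. Only the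
values in `Ω_h^±` matter. -/
def Triangulation.velocitySpace (𝒯 : Triangulation Ω) (ω : Set (Space d)) (m : ℕ) :
    Set (Space d → Space d) :=
  {u | ContinuousOn u (𝒯.extendedDomain ω) ∧
    ∀ s ∈ 𝒯.phaseElements ω, ∃ P : Fin d → MvPolynomial (Fin d) ℝ,
      (∀ i, (P i).totalDegree ≤ m) ∧ Set.EqOn u (polyField P) (openSimplex s)}

open Classical in
/-- The canonical extension to `ℝ^d` of a field `u` that is polynomial on the open simplex `T`
spanned by `s`: the polynomial field which agrees with `u` on `T`. It is unique when `T` is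
nonempty, see `canonicalExt_eq`. (It is `0` if `u` is not polynomial on `T`.) -/
def canonicalExt (u : Space d → Space d) (s : Finset (Space d)) : Space d → Space d :=
  if h : ∃ P : Fin d → MvPolynomial (Fin d) ℝ, Set.EqOn u (polyField P) (openSimplex s) then
    polyField h.choose
  else 0

theorem polyField_eq_of_eqOn {U : Set (Space d)} (hU : IsOpen U) (hne : U.Nonempty)
    {P Q : Fin d → MvPolynomial (Fin d) ℝ} (h : Set.EqOn (polyField P) (polyField Q) U) :
    P = Q := by
  obtain ⟨x, hx⟩ := hne
  have hV : IsOpen ((WithLp.toLp 2 : (Fin d → ℝ) → Space d) ⁻¹' U) :=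
    hU.preimage (PiLp.continuous_toLp 2 _)
  obtain ⟨ε, hε, hball⟩ := Metric.isOpen_iff.1 hV (WithLp.ofLp x) (by simpa using hx)
  funext i
  refine MvPolynomial.funext_set (fun j => Metric.ball (x j) ε) (fun j => ?_) fun y hy => ?_
  · rw [Real.ball_eq_Ioo]
    exact Set.Ioo_infinite (by linarith)
  · have hy' : WithLp.toLp 2 y ∈ U := by
      refine hball ?_
      rw [ball_pi _ hε]
      exact hy
    simpa [polyField] using congrArg (fun z : Space d => z i) (h hy')

theorem canonicalExt_eq {u : Space d → Space d} {s : Finset (Space d)}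
    (hs : (openSimplex s).Nonempty) {P : Fin d → MvPolynomial (Fin d) ℝ}
    (h : Set.EqOn u (polyField P) (openSimplex s)) : canonicalExt u s = polyField P := by
  have hex : ∃ P : Fin d → MvPolynomial (Fin d) ℝ,
      Set.EqOn u (polyField P) (openSimplex s) := ⟨P, h⟩
  rw [canonicalExt, dif_pos hex]
  exact congrArg polyField
    (polyField_eq_of_eqOn isOpen_interior hs (hex.choose_spec.symm.trans h))

open Classical in
/-- The difference `u₁ᵉ - u₂ᵉ` of the canonical extensions from the two elements `T₁, T₂ ∈ 𝒯_h^±`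
that share the facet `e`. (The two elements are numbered arbitrarily, in the same way for all
fields `u`.) -/
def Triangulation.extJump (𝒯 : Triangulation Ω) (ω Γ : Set (Space d)) (e : Finset (Space d))
    (u : Space d → Space d) (x : Space d) : Space d :=
  if h : ∃ T : Finset (Space d) × Finset (Space d), 𝒯.IsGhostFacet ω Γ e T.1 T.2 then
    canonicalExt u h.choose.1 x - canonicalExt u h.choose.2 x
  else 0

/-- The ghost penalty form of one phase,
`J_h^±(u, v) = γ ∑_{e ∈ ℰ_h^{Γ,±}} h_e⁻² ∫_{ω_e} (u₁ᵉ - u₂ᵉ) · (v₁ᵉ - v₂ᵉ) dx`. -/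
def Triangulation.ghostForm (𝒯 : Triangulation Ω) (ω Γ : Set (Space d)) (γ : ℝ)
    (u v : Space d → Space d) : ℝ :=
  γ * ∑ e ∈ 𝒯.ghostFacets ω Γ, 1 / simplexDiam e ^ 2 *
    ∫ x in 𝒯.patch e, inner ℝ (𝒯.extJump ω Γ e u x) (𝒯.extJump ω Γ e v x)

/-- The symmetric gradient `D(u) = (∇u + (∇u)ᵀ) / 2`. -/
def symGrad (u : Space d → Space d) (x : Space d) : Matrix (Fin d) (Fin d) ℝ :=
  Matrix.of fun i j => (1 / 2 : ℝ) *
    (fderiv ℝ u x (EuclideanSpace.single j 1) i + fderiv ℝ u x (EuclideanSpace.single i 1) j)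

/-- `‖D(u)‖²_S`, the squared `L²(S)` norm of the symmetric gradient. -/
def symGradNormSq (u : Space d → Space d) (S : Set (Space d)) : ℝ :=
  ∫ x in S, ∑ i, ∑ j, symGrad u x i j ^ 2

/-- The outer phase `Ω⁺` when `Ωm` is the inner phase `Ω⁻`. -/
def outerPhase (Ω Ωm : Set (Space d)) : Set (Space d) := Ω \ closure Ωm

/-- The interface `Γ = ∂Ω⁻` between the phases. -/
def interface (Ωm : Set (Space d)) : Set (Space d) := frontier Ωm

/-- The two-phase velocity space `V_h^± = V_h^- × V_h^+` of piecewise polynomials of degree at most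
`k + 1`. -/
def Triangulation.twoPhaseVelocitySpace (𝒯 : Triangulation Ω) (Ωm : Set (Space d)) (k : ℕ) :
    Set ((Space d → Space d) × (Space d → Space d)) :=
  𝒯.velocitySpace Ωm (k + 1) ×ˢ 𝒯.velocitySpace (outerPhase Ω Ωm) (k + 1)

/-- The velocity ghost penalty form `a_p(u, v) = μ₋ J_h^-(u⁻, v⁻) + μ₊ J_h^+(u⁺, v⁺)`. -/
def Triangulation.velocityPenalty (𝒯 : Triangulation Ω) (Ωm : Set (Space d))
    (μm μp γm γp : ℝ) (u v : (Space d → Space d) × (Space d → Space d)) : ℝ :=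
  μm * 𝒯.ghostForm Ωm (interface Ωm) γm u.1 v.1 +
    μp * 𝒯.ghostForm (outerPhase Ω Ωm) (interface Ωm) γp u.2 v.2

end TwoPhaseStokes

end

noncomputable section

namespace TwoPhaseStokes

variable {d : ℕ} {Ω : Set (Space d)}

open Metric Filter Topology

/-! ### Polynomial vector fields -/

/-! The estimate is local to a single facet. Let `e` be shared by `s` and `t`, let `P` and `Q` be
the polynomial pieces of the field there, and write `h` for the diameter of `e`.

Symmetric gradients see a polynomial field only up to rigid motions. Since polynomials of bounded
degree form a finite-dimensional space, Korn's inequality modulo rigid motions is linear algebra on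
the unit ball, with the left side measured in the supremum norm on any larger ball. Scaling gives
rigid motions `ρ`, `τ` with `|P - ρ|²` and `|Q - τ|²` at most `C h^(2-d)` times the energies of the
two elements, on a neighbourhood of `e` containing the whole patch (`exists_korn_ball`,
`exists_korn_near_facet`).

Continuity forces `P = Q` at the vertices of `e` (`polyField_eq_on_facet`), so `ρ - τ` is small
there. A rigid motion that is small at the `d` vertices of a facet is small nearby, with constants
controlled by shape regularity (`IsRigid.norm_le`). Hence `|P - Q|² ≤ C h^(2-d) (E_s + E_t)` on the
patch. The patch has volume at most `C h^d`, so integration and the weight `h⁻²` leave `C (E_s +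
E_t)`.

In the sum over facets each element occurs at most `d + 1` times, and distinct open elements are
disjoint inside the extended domain. Only the two elements at a facet enter each local bound, so the
position of the interface plays no role. The phases decouple, so neither do the viscosities. -/

theorem polyField_analyticOnNhd (P : Fin d → MvPolynomial (Fin d) ℝ) :
    AnalyticOnNhd ℝ (polyField P) Set.univ := by
  have h : AnalyticOnNhd ℝ
      (fun x : Space d => fun i => MvPolynomial.eval (fun j => x j) (P i)) Set.univ :=
    AnalyticOnNhd.pi fun i x _ => by
      simpa only [MvPolynomial.aeval_eq_eval] using AnalyticAt.aeval_mvPolynomial (𝕜 := ℝ)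
        (f := fun (x : Space d) j => x j)
        (fun j => (EuclideanSpace.proj j : Space d →L[ℝ] ℝ).analyticAt x) (P i)
  let e : (Fin d → ℝ) →L[ℝ] Space d :=
    ((PiLp.continuousLinearEquiv 2 ℝ (fun _ : Fin d => ℝ)).symm).toContinuousLinearMap
  exact (e.analyticOnNhd Set.univ).comp h (Set.mapsTo_univ _ _)

theorem polyField_differentiable (P : Fin d → MvPolynomial (Fin d) ℝ) :
    Differentiable ℝ (polyField P) := fun x =>
  (polyField_analyticOnNhd P x (Set.mem_univ x)).differentiableAt

theorem polyField_continuous (P : Fin d → MvPolynomial (Fin d) ℝ) :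
    Continuous (polyField P) := (polyField_differentiable P).continuous

theorem polyField_add (P Q : Fin d → MvPolynomial (Fin d) ℝ) :
    polyField (P + Q) = polyField P + polyField Q := by
  ext x i
  simp [polyField]

theorem polyField_smul (c : ℝ) (P : Fin d → MvPolynomial (Fin d) ℝ) :
    polyField (c • P) = c • polyField P := by
  ext x i
  simp [polyField, MvPolynomial.smul_eval]

theorem symGrad_add {u v : Space d → Space d} (hu : Differentiable ℝ u)
    (hv : Differentiable ℝ v) (x : Space d) : symGrad (u + v) x = symGrad u x + symGrad v x := by
  ext i j
  simp only [symGrad, Matrix.of_apply, Matrix.add_apply, fderiv_add (hu x) (hv x),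
    add_apply, PiLp.add_apply]
  ring

theorem symGrad_smul {u : Space d → Space d} (hu : Differentiable ℝ u) (c : ℝ)
    (x : Space d) : symGrad (c • u) x = c • symGrad u x := by
  ext i j
  simp only [symGrad, Matrix.of_apply, Matrix.smul_apply, fderiv_const_smul (hu x),
    smul_apply, PiLp.smul_apply, smul_eq_mul]
  ring

theorem symGrad_polyField_analyticOnNhd (P : Fin d → MvPolynomial (Fin d) ℝ) (i j : Fin d) :
    AnalyticOnNhd ℝ (fun x => symGrad (polyField P) x i j) Set.univ := by
  have h (a b : Fin d) : AnalyticOnNhd ℝ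
      (fun x => fderiv ℝ (polyField P) x (EuclideanSpace.single b 1) a) Set.univ :=
    ((EuclideanSpace.proj a : Space d →L[ℝ] ℝ).comp
      (ContinuousLinearMap.apply ℝ (Space d)
        (EuclideanSpace.single b (1 : ℝ)))).comp_analyticOnNhd
      (polyField_analyticOnNhd P).fderiv
  simpa only [symGrad, Matrix.of_apply] using!
    analyticOnNhd_const.mul ((h i j).add (h j i))

theorem symGrad_polyField_continuous (P : Fin d → MvPolynomial (Fin d) ℝ) (i j : Fin d) :
    Continuous (fun x => symGrad (polyField P) x i j) :=
  continuousOn_univ.1 (symGrad_polyField_analyticOnNhd P i j).continuousOn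

theorem symGrad_congr {u v : Space d → Space d} {U : Set (Space d)} (hU : IsOpen U)
    (h : Set.EqOn u v U) {x : Space d} (hx : x ∈ U) : symGrad u x = symGrad v x := by
  have : fderiv ℝ u x = fderiv ℝ v x := (h.eventuallyEq_of_mem (hU.mem_nhds hx)).fderiv_eq
  simp only [symGrad, this]

/-! ### Infinitesimal rigid motions -/

/-- `ρ` is an infinitesimal rigid motion (a Killing field). -/
def IsRigid (ρ : Space d → Space d) : Prop :=
  ∀ x y, inner ℝ (ρ x - ρ y) (x - y) = 0

theorem IsRigid.sub {ρ τ : Space d → Space d} (hρ : IsRigid ρ) (hτ : IsRigid τ) :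
    IsRigid (ρ - τ) := fun x y => by
  have : (ρ - τ) x - (ρ - τ) y = (ρ x - ρ y) - (τ x - τ y) := by
    simp only [Pi.sub_apply]; abel
  rw [this, inner_sub_left, hρ, hτ, sub_zero]

theorem IsRigid.comp_homothety {ρ : Space d → Space d} (hρ : IsRigid ρ) (x₀ : Space d)
    {r : ℝ} (hr : r ≠ 0) : IsRigid fun x => ρ (r⁻¹ • (x - x₀)) := fun x y => by
  have h := hρ (r⁻¹ • (x - x₀)) (r⁻¹ • (y - x₀))
  rw [← smul_sub, sub_sub_sub_cancel_right, inner_smul_right] at h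
  exact (mul_eq_zero.1 h).resolve_left (inv_ne_zero hr)

/-- The antisymmetric part of the gradient drops out of a quadratic form: the double sum is averaged
with its transpose. -/
theorem inner_fderiv_self (u : Space d → Space d) (x z : Space d) :
    inner ℝ (fderiv ℝ u x z) z = ∑ i, ∑ j, symGrad u x i j * (z i * z j) := by
  have hz : z = ∑ j, z j • EuclideanSpace.single j (1 : ℝ) := by
    ext i
    simp [Finset.sum_apply, Pi.single_apply]
  have h1 : inner ℝ (fderiv ℝ u x z) z =
      ∑ i, ∑ j, fderiv ℝ u x (EuclideanSpace.single j 1) i * (z i * z j) := by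
    rw [PiLp.inner_apply]
    refine Finset.sum_congr rfl fun i _ => ?_
    have : fderiv ℝ u x z i = ∑ j, z j * fderiv ℝ u x (EuclideanSpace.single j 1) i := by
      conv_lhs => rw [hz]
      simp [map_sum]
    rw [this, show ∀ a b : ℝ, inner ℝ a b = a * b from fun a b => mul_comm _ _, Finset.sum_mul]
    exact Finset.sum_congr rfl fun j _ => by ring
  have h2 := h1
  rw [Finset.sum_comm] at h2
  have : inner ℝ (fderiv ℝ u x z) z =
      (1 / 2 : ℝ) * (inner ℝ (fderiv ℝ u x z) z + inner ℝ (fderiv ℝ u x z) z) := by ring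
  rw [this]
  nth_rewrite 1 [h1]
  rw [h2, ← Finset.sum_add_distrib, Finset.mul_sum]
  refine Finset.sum_congr rfl fun i _ => ?_
  rw [← Finset.sum_add_distrib, Finset.mul_sum]
  refine Finset.sum_congr rfl fun j _ => ?_
  simp only [symGrad, Matrix.of_apply]
  ring

/-- Along the segment from `y` to `x`, the component of `u` in the direction `z = x - y` has
derivative `⟨∇u z, z⟩`, which sees only the symmetric gradient. -/
theorem isRigid_of_symGrad_eq_zero {u : Space d → Space d} (hu : Differentiable ℝ u)
    (h : ∀ x, symGrad u x = 0) : IsRigid u := fun x y => by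
  set z := x - y with hz
  have hd : ∀ t : ℝ, HasDerivAt (fun t : ℝ => inner ℝ (u (y + t • z)) z) 0 t := by
    intro t
    have h1 : HasDerivAt (fun t : ℝ => y + t • z) z t := by
      simpa using ((hasDerivAt_id t).smul_const z).const_add y
    have h2 := ((hu (y + t • z)).hasFDerivAt.comp_hasDerivAt t h1).inner ℝ
      (hasDerivAt_const t z)
    simp only [inner_zero_right, zero_add, inner_fderiv_self, h] at h2
    simpa using! h2
  have hc := is_const_of_deriv_eq_zero (fun t => (hd t).differentiableAt)
    (fun t => (hd t).deriv) 1 0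
  simp only [one_smul, zero_smul, add_zero, hz, add_sub_cancel] at hc
  rw [inner_sub_left, hc, sub_self]

/-- Continuity turns vanishing a.e. into vanishing on `U`, and analyticity spreads it to the whole
space. The kernel of the `L²` seminorm on a ball therefore consists of globally rigid fields. -/
theorem isRigid_polyField_of_symGrad_ae_eq_zero {P : Fin d → MvPolynomial (Fin d) ℝ}
    {U : Set (Space d)} (hU : IsOpen U) (hne : U.Nonempty)
    (h : ∀ i j, (fun x => symGrad (polyField P) x i j) =ᵐ[volume.restrict U] 0) :
    IsRigid (polyField P) := by
  refine isRigid_of_symGrad_eq_zero (polyField_differentiable P) fun x => ?_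
  ext i j
  obtain ⟨x₀, hx₀⟩ := hne
  have h1 : Set.EqOn (fun x => symGrad (polyField P) x i j) 0 U :=
    Measure.eqOn_open_of_ae_eq (h i j) hU (symGrad_polyField_continuous P i j).continuousOn
      continuousOn_const
  exact congrFun ((symGrad_polyField_analyticOnNhd P i j).eq_of_eventuallyEq
    (g := 0) analyticOnNhd_const (h1.eventuallyEq_of_mem (hU.mem_nhds hx₀))) x

/-! ### Korn's inequality for polynomial fields -/

/-- On a finite-dimensional space, a linear map is bounded by another one modulo its kernel. -/
theorem exists_norm_sub_ker_le {V X Y : Type*} [AddCommGroup V] [Module ℝ V]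
    [FiniteDimensional ℝ V] [NormedAddCommGroup X] [NormedSpace ℝ X] [NormedAddCommGroup Y]
    [NormedSpace ℝ Y] (S : V →ₗ[ℝ] X) (N : V →ₗ[ℝ] Y) :
    ∃ C : ℝ, 0 ≤ C ∧ ∀ v, ∃ ρ, S ρ = 0 ∧ ‖N (v - ρ)‖ ≤ C * ‖S v‖ := by
  -- A linear section `g` of `S` over its range does everything: `v - g (S v)` lies in the kernel,
  -- and `N ∘ g` is bounded because the range is finite-dimensional. No norm on `V` is needed.
  obtain ⟨g, hg⟩ := S.rangeRestrict.exists_rightInverse_of_surjective S.range_rangeRestrict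
  refine ⟨‖LinearMap.toContinuousLinearMap (N ∘ₗ g)‖, ContinuousLinearMap.opNorm_nonneg _, fun v =>
    ⟨v - g (S.rangeRestrict v), ?_, ?_⟩⟩
  · have := congrArg Subtype.val (LinearMap.congr_fun hg (S.rangeRestrict v))
    rw [map_sub]
    exact sub_eq_zero.2 this.symm
  · rw [sub_sub_cancel]
    exact (LinearMap.toContinuousLinearMap (N ∘ₗ g)).le_opNorm (S.rangeRestrict v)

/-- The symmetric gradient of a field, as a vector of `ℝ^(d × d)`. -/
def symGradVec (u : Space d → Space d) (x : Space d) : EuclideanSpace ℝ (Fin d × Fin d) :=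
  WithLp.toLp 2 fun p => symGrad u x p.1 p.2

theorem norm_symGradVec_sq (u : Space d → Space d) (x : Space d) :
    ‖symGradVec u x‖ ^ 2 = ∑ i, ∑ j, symGrad u x i j ^ 2 := by
  rw [EuclideanSpace.norm_sq_eq, Fintype.sum_prod_type]
  simp [symGradVec]

theorem symGradVec_polyField_continuous (P : Fin d → MvPolynomial (Fin d) ℝ) :
    Continuous (symGradVec (polyField P)) :=
  (PiLp.continuous_toLp 2 _).comp
    (continuous_pi fun p => symGrad_polyField_continuous P p.1 p.2)

theorem symGradVec_polyField_memLp (P : Fin d → MvPolynomial (Fin d) ℝ) (x : Space d) (r : ℝ) :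
    MemLp (symGradVec (polyField P)) 2 (volume.restrict (ball x r)) := by
  obtain ⟨C, hC⟩ := (isCompact_closedBall x r).exists_bound_of_continuousOn
    (symGradVec_polyField_continuous P).continuousOn
  have : IsFiniteMeasure (volume.restrict (ball x r)) :=
    ⟨by rw [Measure.restrict_apply_univ]; exact measure_ball_lt_top⟩
  refine MemLp.of_bound (symGradVec_polyField_continuous P).aestronglyMeasurable C ?_
  filter_upwards [ae_restrict_mem measurableSet_ball] with y hy
  exact hC y (ball_subset_closedBall hy)

/-- `exists_norm_sub_ker_le` is applied with `S` the symmetric gradient in `L²` of the unit ball and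
`N` the restriction to the ball of radius `L` in the supremum norm. A large `L` later lets the
energy of one element control its polynomial on neighbouring elements. -/
theorem exists_korn_unit_ball (d m : ℕ) (L : ℝ) : ∃ C : ℝ, 0 ≤ C ∧
    ∀ P : Fin d → MvPolynomial (Fin d) ℝ, (∀ i, (P i).totalDegree ≤ m) →
      ∃ ρ : Space d → Space d, IsRigid ρ ∧ ∀ z ∈ closedBall (0 : Space d) L,
        ‖polyField P z - ρ z‖ ^ 2 ≤ C * symGradNormSq (polyField P) (ball 0 1) := by
  let V := Fin d → MvPolynomial.restrictTotalDegree (Fin d) ℝ m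
  let p : V → Fin d → MvPolynomial (Fin d) ℝ := fun v i => v i
  let S : V →ₗ[ℝ] Lp (EuclideanSpace ℝ (Fin d × Fin d)) 2
      (volume.restrict (ball (0 : Space d) 1)) :=
    { toFun := fun v => (symGradVec_polyField_memLp (p v) 0 1).toLp _
      map_add' := fun v w => by
        rw [← MemLp.toLp_add]
        congr 1
        have : p (v + w) = p v + p w := rfl
        ext x q
        simp [this, symGradVec, polyField_add,
          symGrad_add (polyField_differentiable _) (polyField_differentiable _)]
      map_smul' := fun c v => by
        rw [RingHom.id_apply, ← MemLp.toLp_const_smul]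
        congr 1
        have : p (c • v) = c • p v := rfl
        ext x q
        simp [this, symGradVec, polyField_smul, symGrad_smul (polyField_differentiable _)] }
  let N : V →ₗ[ℝ] C(closedBall (0 : Space d) L, Space d) :=
    { toFun := fun v => ⟨fun z => polyField (p v) z,
        (polyField_continuous _).comp continuous_subtype_val⟩
      map_add' := fun v w => by
        have : p (v + w) = p v + p w := rfl
        ext z
        simp [this, polyField_add]
      map_smul' := fun c v => by
        have : p (c • v) = c • p v := rfl
        ext z
        simp [this, polyField_smul] }
  have : CompactSpace (closedBall (0 : Space d) L) :=
    isCompact_iff_compactSpace.1 (isCompact_closedBall _ _)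
  obtain ⟨C, hC, h⟩ := exists_norm_sub_ker_le S N
  refine ⟨C ^ 2, sq_nonneg C, fun P hP => ?_⟩
  let v : V := fun i => ⟨P i, (MvPolynomial.mem_restrictTotalDegree _ _ _).2 (hP i)⟩
  obtain ⟨w, hw, hb⟩ := h v
  have hS : ‖S v‖ ^ 2 = symGradNormSq (polyField P) (ball 0 1) := by
    rw [← real_inner_self_eq_norm_sq, L2.inner_def, symGradNormSq]
    refine integral_congr_ae ?_
    filter_upwards [(symGradVec_polyField_memLp (p v) 0 1).coeFn_toLp] with x hx
    have hx' : (S v : Space d → _) x = symGradVec (polyField P) x := hx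
    rw [hx', real_inner_self_eq_norm_sq, norm_symGradVec_sq]
  refine ⟨polyField (p w), ?_, fun z hz => ?_⟩
  · refine isRigid_polyField_of_symGrad_ae_eq_zero isOpen_ball ⟨0, mem_ball_self one_pos⟩
      fun i j => ?_
    have h0 := (symGradVec_polyField_memLp (p w) 0 1).coeFn_toLp
    have h1 : (symGradVec_polyField_memLp (p w) 0 1).toLp _ = 0 := hw
    rw [h1] at h0
    filter_upwards [h0, Lp.coeFn_zero (EuclideanSpace ℝ (Fin d × Fin d)) 2
      (volume.restrict (ball (0 : Space d) 1))] with x hx hx0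
    rw [hx0] at hx
    have := congrArg (fun q : EuclideanSpace ℝ (Fin d × Fin d) => q (i, j)) hx
    simpa [symGradVec] using this.symm
  · have h1 : ‖polyField P z - polyField (p w) z‖ ≤ C * ‖S v‖ := by
      refine le_trans ?_ hb
      have h2 := ContinuousMap.norm_coe_le_norm (N (v - w)) ⟨z, hz⟩
      have h3 : N (v - w) ⟨z, hz⟩ = polyField P z - polyField (p w) z := by
        rw [map_sub]
        rfl
      rwa [h3] at h2
    calc _ ≤ (C * ‖S v‖) ^ 2 := by gcongr
      _ = _ := by rw [mul_pow, hS]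

theorem exists_polyField_homothety {m : ℕ} {P : Fin d → MvPolynomial (Fin d) ℝ}
    (hP : ∀ i, (P i).totalDegree ≤ m) (x₀ : Space d) (r : ℝ) :
    ∃ Q : Fin d → MvPolynomial (Fin d) ℝ, (∀ i, (Q i).totalDegree ≤ m) ∧
      ∀ z, polyField Q z = polyField P (x₀ + r • z) := by
  let g : Fin d → MvPolynomial (Fin d) ℝ := fun j =>
    MvPolynomial.C (x₀ j) + MvPolynomial.C r * MvPolynomial.X j
  have hg : ∀ j, (g j).totalDegree ≤ 1 := fun j => by
    refine (MvPolynomial.totalDegree_add _ _).trans (max_le (by simp) ?_)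
    refine (MvPolynomial.totalDegree_mul _ _).trans ?_
    simp
  refine ⟨fun i => MvPolynomial.bind₁ g (P i), fun i => ?_, fun z => ?_⟩
  · rw [MvPolynomial.bind₁]
    simp only
    rw [MvPolynomial.aeval_def, MvPolynomial.eval₂_eq]
    refine MvPolynomial.totalDegree_finsetSum_le fun n hn => ?_
    refine (MvPolynomial.totalDegree_mul _ _).trans ?_
    have h1 : (∏ j ∈ n.support, g j ^ n j).totalDegree ≤ ∑ j ∈ n.support, n j := by
      refine (MvPolynomial.totalDegree_finsetProd _ _).trans (Finset.sum_le_sum fun j _ => ?_)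
      refine (MvPolynomial.totalDegree_pow _ _).trans ?_
      simpa using Nat.mul_le_mul_left (n j) (hg j)
    have h2 : ∑ j ∈ n.support, n j ≤ m := (MvPolynomial.le_totalDegree hn).trans (hP i)
    simpa [MvPolynomial.algebraMap_eq] using h1.trans h2
  · ext i
    simp only [polyField]
    rw [← MvPolynomial.coe_aeval_eq_eval, RingHom.coe_coe, MvPolynomial.aeval_bind₁,
      ← MvPolynomial.coe_aeval_eq_eval, RingHom.coe_coe]
    simp [g]

theorem symGrad_comp_homothety {u v : Space d → Space d} (hu : Differentiable ℝ u)
    {x₀ : Space d} {r : ℝ} (hv : ∀ z, v z = u (x₀ + r • z)) (z : Space d) :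
    symGrad v z = r • symGrad u (x₀ + r • z) := by
  have h1 : HasFDerivAt (fun z : Space d => x₀ + r • z)
      (r • ContinuousLinearMap.id ℝ (Space d)) z :=
    ((hasFDerivAt_id z).const_smul r).const_add x₀
  have h2 : fderiv ℝ v z =
      (fderiv ℝ u (x₀ + r • z)).comp (r • ContinuousLinearMap.id ℝ (Space d)) := by
    rw [funext hv]
    exact ((hu _).hasFDerivAt.comp z h1).fderiv
  ext i j
  simp [symGrad, h2]
  ring

theorem setIntegral_unit_ball_comp_homothety (f : Space d → ℝ) (x₀ : Space d) {r : ℝ}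
    (hr : 0 < r) : ∫ z in ball (0 : Space d) 1, f (x₀ + r • z) =
      (r ^ d)⁻¹ * ∫ x in ball x₀ r, f x := by
  have h1 := Measure.setIntegral_comp_smul_of_pos volume (fun y => f (x₀ + y))
    (ball (0 : Space d) 1) hr
  rw [smul_unitBall hr.ne', finrank_euclideanSpace_fin, Real.norm_of_nonneg hr.le] at h1
  rw [h1, smul_eq_mul]
  congr 1
  have h2 := (measurePreserving_add_left volume x₀).setIntegral_preimage_emb
    (measurableEmbedding_addLeft x₀) f (ball x₀ r)
  rw [← h2]
  simp [preimage_add_ball]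

/-- Korn's inequality for polynomial fields on balls, modulo rigid motions. -/
theorem exists_korn_ball (d m : ℕ) (L : ℝ) : ∃ C : ℝ, 0 ≤ C ∧
    ∀ P : Fin d → MvPolynomial (Fin d) ℝ, (∀ i, (P i).totalDegree ≤ m) →
      ∀ (x₀ : Space d) (r : ℝ), 0 < r →
      ∃ ρ : Space d → Space d, IsRigid ρ ∧ ∀ x ∈ closedBall x₀ (L * r),
        ‖polyField P x - ρ x‖ ^ 2 ≤
          C * (r ^ 2 * (r ^ d)⁻¹ * symGradNormSq (polyField P) (ball x₀ r)) := by
  obtain ⟨C, hC, h⟩ := exists_korn_unit_ball d m L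
  refine ⟨C, hC, fun P hP x₀ r hr => ?_⟩
  obtain ⟨Q, hQ, hQP⟩ := exists_polyField_homothety hP x₀ r
  obtain ⟨ρ, hρ, hb⟩ := h Q hQ
  refine ⟨_, hρ.comp_homothety x₀ hr.ne', fun x hx => ?_⟩
  have hx' : r⁻¹ • (x - x₀) ∈ closedBall (0 : Space d) L := by
    rw [mem_closedBall_zero_iff, norm_smul, norm_inv, Real.norm_of_nonneg hr.le,
      inv_mul_le_iff₀ hr, mul_comm, ← dist_eq_norm]
    exact hx
  have h1 := hb _ hx'
  rw [hQP, smul_inv_smul₀ hr.ne', add_sub_cancel] at h1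
  refine h1.trans_eq ?_
  congr 1
  -- The symmetric gradient of the rescaled field gains a factor `r`, hence `r ^ 2` here; the change
  -- of variables supplies `(r ^ d)⁻¹`.
  have h2 : ∀ z, ∑ i, ∑ j, symGrad (polyField Q) z i j ^ 2 =
      r ^ 2 * ∑ i, ∑ j, symGrad (polyField P) (x₀ + r • z) i j ^ 2 := fun z => by
    rw [symGrad_comp_homothety (polyField_differentiable P) hQP]
    simp only [Matrix.smul_apply, smul_eq_mul, mul_pow, Finset.mul_sum]
  simp only [symGradNormSq, h2]
  rw [integral_const_mul, setIntegral_unit_ball_comp_homothety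
    (fun x => ∑ i, ∑ j, symGrad (polyField P) x i j ^ 2) x₀ hr, mul_assoc]

/-! ### Simplices containing a ball -/

/-- Up to the factor `‖y‖ / (2 * r)`, `y` is the difference of two antipodal points of the ball.
Both are convex combinations of the vertices, so their weights differ by at most `1`, and the
differences sum to zero, which makes the base point `c` arbitrary. This replaces any bound on the
inverse of an edge matrix. -/
theorem exists_sum_smul_sub_of_closedBall_subset {s : Finset (Space d)} {x₀ : Space d} {r : ℝ}
    (hr : 0 < r) (hB : closedBall x₀ r ⊆ closedSimplex s) (c y : Space d) :
    ∃ g : Space d → ℝ, ∑ v ∈ s, g v • (v - c) = y ∧ ∀ v ∈ s, |g v| ≤ ‖y‖ / (2 * r) := by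
  rcases eq_or_ne y 0 with rfl | hy
  · exact ⟨0, by simp, by simp⟩
  have hy' : 0 < ‖y‖ := norm_pos_iff.2 hy
  have hu : ‖(r / ‖y‖) • y‖ = r := by
    rw [norm_smul, norm_div, norm_norm, Real.norm_of_nonneg hr.le, div_mul_cancel₀ _ hy'.ne']
  have hp : x₀ + (r / ‖y‖) • y ∈ closedSimplex s := hB (by simp [hu])
  have hm : x₀ - (r / ‖y‖) • y ∈ closedSimplex s := hB (by simp [hu])
  rw [closedSimplex, Finset.mem_convexHull'] at hp hm
  obtain ⟨w, hw0, hw1, hw⟩ := hp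
  obtain ⟨w', hw0', hw1', hw'⟩ := hm
  have hwle : ∀ v ∈ s, w v ≤ 1 := fun v hv => hw1 ▸ Finset.single_le_sum hw0 hv
  have hwle' : ∀ v ∈ s, w' v ≤ 1 := fun v hv => hw1' ▸ Finset.single_le_sum hw0' hv
  refine ⟨fun v => ‖y‖ / (2 * r) * (w v - w' v), ?_, fun v hv => ?_⟩
  · have h1 : ∑ v ∈ s, (w v - w' v) • (v - c) = (2 * (r / ‖y‖)) • y := by
      simp only [smul_sub, sub_smul, Finset.sum_sub_distrib, ← Finset.sum_smul, hw, hw', hw1, hw1']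
      module
    simp_rw [mul_smul (‖y‖ / (2 * r)), ← Finset.smul_sum, h1]
    rw [← mul_smul, show ‖y‖ / (2 * r) * (2 * (r / ‖y‖)) = 1 by field_simp, one_smul]
  · rw [abs_mul, abs_of_nonneg (by positivity)]
    refine mul_le_of_le_one_right (by positivity) (abs_le.2 ⟨?_, ?_⟩)
    · linarith [hw0 v hv, hwle' v hv]
    · linarith [hw0' v hv, hwle v hv]

open Classical in
/-- The barycentric coordinates of a simplex of full dimension. -/
theorem exists_barycentric {s : Finset (Space d)} (hcard : s.card = d + 1)
    (hs : AffineIndependent ℝ ((↑) : s → Space d)) :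
    ∃ l : Space d → Space d →ᵃ[ℝ] ℝ, (∀ v ∈ s, ∀ w ∈ s, l v w = if v = w then 1 else 0) ∧
      ∀ x, x ∈ closedSimplex s ↔ ∀ v ∈ s, 0 ≤ l v x := by
  have htop : affineSpan ℝ (Set.range ((↑) : s → Space d)) = ⊤ :=
    hs.affineSpan_eq_top_iff_card_eq_finrank_add_one.2 (by simp [hcard])
  let b : AffineBasis s ℝ (Space d) := ⟨(↑), hs, htop⟩
  have hb : ∀ i : s, b i = (i : Space d) := fun _ => rfl
  refine ⟨fun v => if h : v ∈ s then b.coord ⟨v, h⟩ else 0, fun v hv w hw => ?_, fun x => ?_⟩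
  · have := b.coord_apply ⟨v, hv⟩ ⟨w, hw⟩
    rw [hb] at this
    simpa [hv] using this
  · have h1 : closedSimplex s = {x | ∀ i, 0 ≤ b.coord i x} := by
      rw [← b.convexHull_eq_nonneg_coord, closedSimplex]
      congr 1
      exact Subtype.range_coe.symm
    rw [h1, Set.mem_ofPred_eq]
    constructor
    · intro h v hv
      simpa [hv] using h ⟨v, hv⟩
    · intro h i
      simpa using h i i.2

theorem affineMap_sum_smul {E : Type*} [AddCommGroup E] [Module ℝ E] (f : E →ᵃ[ℝ] ℝ)
    (s : Finset E) (w : E → ℝ) (hw : ∑ v ∈ s, w v = 1) :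
    f (∑ v ∈ s, w v • v) = ∑ v ∈ s, w v * f v := by
  obtain ⟨c, hf⟩ : ∃ c, ∀ x, f x = f.linear x + c := ⟨f 0, fun x => congrFun f.decomp x⟩
  simp only [hf, map_sum, mul_add, Finset.sum_add_distrib, ← Finset.sum_mul, hw, one_mul,
    map_smul, smul_eq_mul]

/-- Expand `p - q` in the vectors `v - q` with bounded coefficients. The barycentric coordinate of
`p` shows that the coefficient at `p` is `1`, so `1 ≤ ‖p - q‖ / (2 * r)`. -/
theorem two_mul_le_norm_sub_of_closedBall_subset {s : Finset (Space d)} {x₀ : Space d} {r : ℝ}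
    (hr : 0 < r) (hB : closedBall x₀ r ⊆ closedSimplex s) (hcard : s.card = d + 1)
    (hs : AffineIndependent ℝ ((↑) : s → Space d)) {p q : Space d} (hp : p ∈ s) (hq : q ∈ s)
    (hpq : p ≠ q) : 2 * r ≤ ‖p - q‖ := by
  obtain ⟨l, hl, -⟩ := exists_barycentric hcard hs
  obtain ⟨g, hg, hgb⟩ := exists_sum_smul_sub_of_closedBall_subset hr hB q (p - q)
  have hlin : ∀ v ∈ s, (l p).linear (v - q) = if p = v then 1 else 0 := fun v hv => by
    rw [← vsub_eq_sub, AffineMap.linearMap_vsub, hl p hp v hv, hl p hp q hq, if_neg hpq,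
      vsub_eq_sub, sub_zero]
  have h1 := congrArg (l p).linear hg
  rw [map_sum, hlin p hp, if_pos rfl] at h1
  rw [Finset.sum_congr rfl fun v hv => by rw [map_smul, hlin v hv, smul_eq_mul]] at h1
  simp only [mul_ite, mul_one, mul_zero, Finset.sum_ite_eq, if_pos hp] at h1
  have h3 := hgb p hp
  rw [h1, abs_one, le_div_iff₀ (by positivity)] at h3
  linarith

theorem IsRigid.inner_antisymm {ρ : Space d → Space d} (hρ : IsRigid ρ) (c x y : Space d) :
    inner ℝ (ρ x - ρ c) (y - c) = -inner ℝ (ρ y - ρ c) (x - c) := by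
  have h1 := hρ x y
  have h2 := hρ x c
  have h3 := hρ y c
  simp only [inner_sub_left, inner_sub_right] at *
  linarith

/-- By antisymmetry, testing `ρ x - ρ c` against a facet edge `v - c` amounts to testing `ρ v - ρ
c`, of size at most `2 * δ`, against `x - c`. For the remaining edge `a - c`, swap likewise and
expand `x - c` in edges: the term along `a - c` vanishes by rigidity, the others are facet edges.
With all edges tested, expanding `ρ x - ρ c` itself in edges bounds its norm. -/
theorem IsRigid.norm_le {ρ : Space d → Space d} (hρ : IsRigid ρ) {s e : Finset (Space d)}
    {x₀ : Space d} {r : ℝ} (hr : 0 < r) (hB : closedBall x₀ r ⊆ closedSimplex s) {a c : Space d}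
    (ha : a ∈ s) (hse : ∀ v ∈ s, v = a ∨ v ∈ e) (hc : c ∈ e) {h δ : ℝ} (hh : ‖a - c‖ ≤ h)
    (hδ : ∀ v ∈ e, ‖ρ v‖ ≤ δ) (x : Space d) :
    ‖ρ x‖ ≤ δ + s.card / (2 * r) * (‖x - c‖ * (2 * δ + s.card / r * (δ * h))) := by
  have hδ0 : 0 ≤ δ := (norm_nonneg _).trans (hδ c hc)
  have hh0 : 0 ≤ h := (norm_nonneg _).trans hh
  have he : ∀ x, ∀ v ∈ e, |inner ℝ (ρ x - ρ c) (v - c)| ≤ 2 * δ * ‖x - c‖ := fun x v hv => by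
    rw [hρ.inner_antisymm c, abs_neg]
    refine (abs_real_inner_le_norm _ _).trans ?_
    gcongr
    linarith [norm_sub_le (ρ v) (ρ c), hδ v hv, hδ c hc]
  have hadd : ∀ x, |inner ℝ (ρ x - ρ c) (a - c)| ≤ s.card / r * (δ * h) * ‖x - c‖ := fun x => by
    obtain ⟨g, hg, hgb⟩ := exists_sum_smul_sub_of_closedBall_subset hr hB c (x - c)
    rw [hρ.inner_antisymm c, abs_neg, ← hg, inner_sum]
    calc |∑ v ∈ s, inner ℝ (ρ a - ρ c) (g v • (v - c))|
        ≤ ∑ v ∈ s, |inner ℝ (ρ a - ρ c) (g v • (v - c))| := Finset.abs_sum_le_sum_abs _ _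
      _ ≤ ∑ v ∈ s, ‖x - c‖ / (2 * r) * (2 * δ * h) := Finset.sum_le_sum fun v hv => by
          rw [inner_smul_right, abs_mul]
          refine mul_le_mul (hgb v hv) ?_ (abs_nonneg _) (by positivity)
          rcases hse v hv with rfl | hv'
          · rw [hρ, abs_zero]
            positivity
          · exact (he a v hv').trans (by gcongr)
      _ = s.card / r * (δ * h) * ‖x - c‖ := by
          rw [Finset.sum_const, nsmul_eq_mul]
          field_simp
      _ = _ := by rw [hg]
  set B := ‖x - c‖ * (2 * δ + s.card / r * (δ * h)) with hBdef
  have hB0 : 0 ≤ B := by positivity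
  have hall : ∀ v ∈ s, |inner ℝ (ρ x - ρ c) (v - c)| ≤ B := fun v hv => by
    have h1 : 0 ≤ 2 * δ * ‖x - c‖ := by positivity
    have h2 : 0 ≤ s.card / r * (δ * h) * ‖x - c‖ := by positivity
    rcases hse v hv with rfl | hv'
    · linarith [hadd x]
    · linarith [he x v hv']
  obtain ⟨g, hg, hgb⟩ := exists_sum_smul_sub_of_closedBall_subset hr hB c (ρ x - ρ c)
  have hsq : ‖ρ x - ρ c‖ * ‖ρ x - ρ c‖ ≤ ‖ρ x - ρ c‖ * (s.card / (2 * r) * B) := by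
    rw [← real_inner_self_eq_norm_mul_norm]
    nth_rewrite 2 [← hg]
    rw [inner_sum]
    calc ∑ v ∈ s, inner ℝ (ρ x - ρ c) (g v • (v - c))
        ≤ ∑ v ∈ s, ‖ρ x - ρ c‖ / (2 * r) * B := Finset.sum_le_sum fun v hv => by
          rw [inner_smul_right]
          refine (le_abs_self _).trans ?_
          rw [abs_mul]
          exact mul_le_mul (hgb v hv) (hall v hv) (abs_nonneg _) (by positivity)
      _ = _ := by
          rw [Finset.sum_const, nsmul_eq_mul]
          field_simp
  have hfin : ‖ρ x - ρ c‖ ≤ s.card / (2 * r) * B := by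
    rcases (norm_nonneg (ρ x - ρ c)).eq_or_lt with h0 | h0
    · rw [← h0]
      positivity
    · exact le_of_mul_le_mul_left hsq h0
  calc ‖ρ x‖ = ‖ρ c + (ρ x - ρ c)‖ := by rw [add_sub_cancel]
    _ ≤ ‖ρ c‖ + ‖ρ x - ρ c‖ := norm_add_le _ _
    _ ≤ _ := add_le_add (hδ c hc) hfin

/-! ### Geometry of triangulations -/

theorem isCompact_closedSimplex (s : Finset (Space d)) : IsCompact (closedSimplex s) :=
  s.finite_toSet.isCompact_convexHull (𝕜 := ℝ)

theorem convex_closedSimplex (s : Finset (Space d)) : Convex ℝ (closedSimplex s) :=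
  convex_convexHull ℝ _

theorem subset_closedSimplex (s : Finset (Space d)) : (s : Set (Space d)) ⊆ closedSimplex s :=
  subset_convexHull ℝ _

theorem closedSimplex_mono {s t : Finset (Space d)} (h : s ⊆ t) :
    closedSimplex s ⊆ closedSimplex t :=
  convexHull_mono (Finset.coe_subset.2 h)

theorem norm_sub_le_simplexDiam {s : Finset (Space d)} {x y : Space d}
    (hx : x ∈ closedSimplex s) (hy : y ∈ closedSimplex s) : ‖x - y‖ ≤ simplexDiam s := by
  rw [← dist_eq_norm]
  exact dist_le_diam_of_mem (isCompact_closedSimplex s).isBounded hx hy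

theorem simplexDiam_mono {s t : Finset (Space d)} (h : s ⊆ t) :
    simplexDiam s ≤ simplexDiam t :=
  diam_mono (closedSimplex_mono h) (isCompact_closedSimplex t).isBounded

theorem closedSimplex_ae_eq_openSimplex (s : Finset (Space d)) :
    closedSimplex s =ᵐ[volume] openSimplex s :=
  (interior_ae_eq_of_null_frontier
    ((convex_closedSimplex s).addHaar_frontier volume)).symm

/-- Points in the relative interior of the common facet of two simplices are interior to their
union. -/
theorem mem_interior_union_of_pos {s t e : Finset (Space d)} {a b : Space d}
    (hs : s.card = d + 1) (hsi : AffineIndependent ℝ ((↑) : s → Space d))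
    (ht : t.card = d + 1) (hti : AffineIndependent ℝ ((↑) : t → Space d))
    (hes : e ⊆ s) (het : e ⊆ t) (has : a ∈ s) (hbt : b ∈ t) (hae : a ∉ e) (hbe : b ∉ e)
    (hse : ∀ v ∈ s, v = a ∨ v ∈ e) (hte : ∀ v ∈ t, v = b ∨ v ∈ e)
    (hst : closedSimplex s ∩ closedSimplex t ⊆ closedSimplex e)
    {w : Space d → ℝ} (hw : ∀ v ∈ e, 0 < w v) (hw1 : ∑ v ∈ e, w v = 1) :
    ∑ v ∈ e, w v • v ∈ interior (closedSimplex s ∪ closedSimplex t) := by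
  obtain ⟨l, hl, hls⟩ := exists_barycentric hs hsi
  obtain ⟨m, hm, hmt⟩ := exists_barycentric ht hti
  set x := ∑ v ∈ e, w v • v with hx
  have hlx : ∀ v ∈ e, 0 < l v x := fun v hv => by
    classical
    rw [hx, affineMap_sum_smul _ _ _ hw1,
      Finset.sum_congr rfl fun y hy => by rw [hl v (hes hv) y (hes hy)]]
    simpa [hv] using hw v hv
  have hmx : ∀ v ∈ e, 0 < m v x := fun v hv => by
    classical
    rw [hx, affineMap_sum_smul _ _ _ hw1,
      Finset.sum_congr rfl fun y hy => by rw [hm v (het hv) y (het hy)]]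
    simpa [hv] using hw v hv
  have hla : ∀ y ∈ closedSimplex e, l a y = 0 := fun y hy => by
    have h1 : closedSimplex e ⊆ l a ⁻¹' {0} :=
      convexHull_min (fun v hv => by
        have := hl a has v (hes hv)
        rwa [if_neg (fun h : a = v => hae (h ▸ hv))] at this) ((convex_singleton 0).affine_preimage _)
    exact h1 hy
  have hmb : ∀ y ∈ closedSimplex e, m b y = 0 := fun y hy => by
    have h1 : closedSimplex e ⊆ m b ⁻¹' {0} :=
      convexHull_min (fun v hv => by
        have := hm b hbt v (het hv)
        rwa [if_neg (fun h : b = v => hbe (h ▸ hv))] at this) ((convex_singleton 0).affine_preimage _)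
    exact h1 hy
  have hxe : x ∈ closedSimplex e := by
    rw [closedSimplex, Finset.mem_convexHull']
    exact ⟨w, fun v hv => (hw v hv).le, hw1, rfl⟩
  have hcont : ∀ f : Space d →ᵃ[ℝ] ℝ, Continuous f := fun f => f.continuous_of_finiteDimensional
  have hev : ∀ᶠ y in 𝓝 x, (∀ v ∈ e, 0 < l v y) ∧ ∀ v ∈ e, 0 < m v y := by
    refine Filter.Eventually.and ?_ ?_
    · exact (Finset.eventually_all e).2 fun v hv =>
        (hcont (l v)).continuousAt.eventually (lt_mem_nhds (hlx v hv))
    · exact (Finset.eventually_all e).2 fun v hv =>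
        (hcont (m v)).continuousAt.eventually (lt_mem_nhds (hmx v hv))
  -- Reflection through `x` decides the case of a point `y` outside both simplices. There `l a` and
  -- `m b` are negative at `y`, and both are odd about `x`, so the mirror image lies in both
  -- simplices, hence in `closedSimplex e`, where `l a` vanishes.
  have hrefl : Tendsto (fun y : Space d => x + (x - y)) (𝓝 x) (𝓝 x) := by
    have : Continuous fun y : Space d => x + (x - y) := by fun_prop
    simpa using this.tendsto x
  rw [mem_interior_iff_mem_nhds]
  filter_upwards [hev, hrefl.eventually hev] with y hy hy'
  by_cases h1 : 0 ≤ l a y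
  · refine Or.inl ((hls y).2 fun v hv => ?_)
    rcases hse v hv with rfl | hv'
    · exact h1
    · exact (hy.1 v hv').le
  by_cases h2 : 0 ≤ m b y
  · refine Or.inr ((hmt y).2 fun v hv => ?_)
    rcases hte v hv with rfl | hv'
    · exact h2
    · exact (hy.2 v hv').le
  exfalso
  have hreflect : ∀ f : Space d →ᵃ[ℝ] ℝ, f x = 0 → f (x + (x - y)) = -f y := fun f hf => by
    have h3 := f.map_vadd x (x - y)
    have h4 := f.linearMap_vsub x y
    simp only [vadd_eq_add, vsub_eq_sub] at h3 h4
    rw [add_comm x, h3, h4, hf]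
    ring
  have hl' := hreflect (l a) (hla x hxe)
  have hm' := hreflect (m b) (hmb x hxe)
  have h5 : x + (x - y) ∈ closedSimplex e := by
    refine hst ⟨(hls _).2 fun v hv => ?_, (hmt _).2 fun v hv => ?_⟩
    · rcases hse v hv with rfl | hv'
      · linarith
      · exact (hy'.1 v hv').le
    · rcases hte v hv with rfl | hv'
      · linarith
      · exact (hy'.2 v hv').le
  have h6 := hla _ h5
  linarith

/-- Move `v` slightly towards the barycentre: the weights `W τ` are positive for `0 < τ < 1`. -/
theorem mem_closure_relInterior {e : Finset (Space d)} {v : Space d} (hv : v ∈ e) :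
    v ∈ closure {x | ∃ w : Space d → ℝ, (∀ y ∈ e, 0 < w y) ∧ ∑ y ∈ e, w y = 1 ∧
      x = ∑ y ∈ e, w y • y} := by
  classical
  have hcard : (0 : ℝ) < e.card := by exact_mod_cast Finset.card_pos.2 ⟨v, hv⟩
  let W : ℝ → Space d → ℝ := fun τ y => (1 - τ) * (if y = v then 1 else 0) + τ / e.card
  have hcont : Continuous fun τ => ∑ y ∈ e, W τ y • y := by
    refine continuous_finsetSum _ fun y _ => ?_
    have : Continuous fun τ => W τ y := by fun_prop
    exact this.smul continuous_const
  have h0 : ∑ y ∈ e, W 0 y • y = v := by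
    simp [W, ite_smul, hv]
  have ht : Tendsto (fun τ => ∑ y ∈ e, W τ y • y) (𝓝[>] 0) (𝓝 v) := by
    have := hcont.tendsto 0
    rw [h0] at this
    exact this.mono_left nhdsWithin_le_nhds
  refine mem_closure_of_tendsto ht ?_
  have hmem : Set.Ioo (0 : ℝ) 1 ∈ 𝓝[>] (0 : ℝ) := Ioo_mem_nhdsGT one_pos
  filter_upwards [hmem] with τ hτ
  refine ⟨W τ, fun y _ => ?_, ?_, rfl⟩
  · have h1 : 0 < τ / e.card := div_pos hτ.1 hcard
    have h2 : 0 ≤ (1 - τ) * (if y = v then (1 : ℝ) else 0) :=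
      mul_nonneg (by linarith [hτ.2]) (by split_ifs <;> norm_num)
    exact add_pos_of_nonneg_of_pos h2 h1
  · simp only [W, Finset.sum_add_distrib, ← Finset.mul_sum, Finset.sum_ite_eq', if_pos hv,
      Finset.sum_const, nsmul_eq_mul]
    field_simp
    ring

namespace Triangulation

variable (𝒯 : Triangulation Ω) {ω : Set (Space d)} {s t e : Finset (Space d)}

theorem mem_elements : s ∈ 𝒯.elements ↔ s ∈ 𝒯.complex.faces ∧ s.card = d + 1 := by
  simp [elements]

theorem mem_phaseElements :
    s ∈ 𝒯.phaseElements ω ↔ s ∈ 𝒯.elements ∧ (openSimplex s ∩ ω).Nonempty := by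
  simp [phaseElements]

variable {𝒯}

theorem affineIndependent_of_mem_elements (hs : s ∈ 𝒯.elements) :
    AffineIndependent ℝ ((↑) : s → Space d) :=
  𝒯.complex.indep (𝒯.mem_elements.1 hs).1

open Classical in
theorem closedSimplex_inter_subset (hs : s ∈ 𝒯.elements) (ht : t ∈ 𝒯.elements) :
    closedSimplex s ∩ closedSimplex t ⊆ closedSimplex (s ∩ t) := by
  have := 𝒯.complex.inter_subset_convexHull (𝒯.mem_elements.1 hs).1 (𝒯.mem_elements.1 ht).1
  simpa [closedSimplex] using this

/-- If the interiors met, the common face would have interior points and span the whole space,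
including a vertex of `s` outside it, against affine independence. -/
theorem disjoint_openSimplex (hs : s ∈ 𝒯.elements) (ht : t ∈ 𝒯.elements) (hst : s ≠ t) :
    Disjoint (openSimplex s) (openSimplex t) := by
  classical
  rw [Set.disjoint_iff_inter_eq_empty, ← Set.not_nonempty_iff_eq_empty]
  intro hne
  have h1 : openSimplex s ∩ openSimplex t ⊆ interior (closedSimplex (s ∩ t)) := by
    rw [openSimplex, openSimplex, ← interior_inter]
    exact interior_mono (closedSimplex_inter_subset hs ht)
  have h2 := interior_convexHull_nonempty_iff_affineSpan_eq_top.1 (hne.mono h1)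
  obtain ⟨a, has, hat⟩ : ∃ a ∈ s, a ∉ t := by
    by_contra! hsub
    exact hst (Finset.eq_of_subset_of_card_le hsub
      (by rw [(𝒯.mem_elements.1 hs).2, (𝒯.mem_elements.1 ht).2]))
  have h3 := (affineIndependent_of_mem_elements hs).notMem_affineSpan_sdiff ⟨a, has⟩ Set.univ
  apply h3
  have h4 : ((s ∩ t : Finset (Space d)) : Set (Space d)) ⊆
      ((↑) : s → Space d) '' (Set.univ \ {⟨a, has⟩}) := fun v hv => by
    have hv' := Finset.mem_inter.1 (Finset.mem_coe.1 hv)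
    refine ⟨⟨v, hv'.1⟩, ⟨trivial, fun h => hat ?_⟩, rfl⟩
    have : v = a := congrArg Subtype.val h
    exact this ▸ hv'.2
  refine affineSpan_mono ℝ h4 ?_
  rw [h2]
  trivial

theorem openSimplex_nonempty (hs : s ∈ 𝒯.phaseElements ω) : (openSimplex s).Nonempty :=
  (𝒯.mem_phaseElements.1 hs).2.mono Set.inter_subset_left

theorem openSimplex_subset_extendedDomain (hs : s ∈ 𝒯.phaseElements ω) :
    openSimplex s ⊆ 𝒯.extendedDomain ω :=
  interior_mono (Set.subset_biUnion_of_mem (u := fun s => closedSimplex s) hs)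

open Classical in
/-- The polynomials of a continuous field on two elements agree on their common facet. -/
theorem polyField_eq_on_facet {m : ℕ} {u : Space d → Space d} (hu : u ∈ 𝒯.velocitySpace ω m)
    (hs : s ∈ 𝒯.phaseElements ω) (ht : t ∈ 𝒯.phaseElements ω)
    (hcard : (s ∩ t).card = d) {P Q : Fin d → MvPolynomial (Fin d) ℝ}
    (hP : Set.EqOn u (polyField P) (openSimplex s))
    (hQ : Set.EqOn u (polyField Q) (openSimplex t)) {v : Space d} (hv : v ∈ s ∩ t) :
    polyField P v = polyField Q v := by
  have hs' := (𝒯.mem_phaseElements.1 hs).1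
  have ht' := (𝒯.mem_phaseElements.1 ht).1
  have hsc := (𝒯.mem_elements.1 hs').2
  have htc := (𝒯.mem_elements.1 ht').2
  obtain ⟨a, ha⟩ := Finset.card_eq_one.1
    (show (s \ t).card = 1 by have := Finset.card_inter_add_card_sdiff s t; omega)
  obtain ⟨b, hb⟩ := Finset.card_eq_one.1
    (show (t \ s).card = 1 by
      have := Finset.card_inter_add_card_sdiff t s; rw [Finset.inter_comm] at this; omega)
  have ha' : ∀ x, (x ∈ s ∧ x ∉ t) ↔ x = a := fun x => by
    rw [← Finset.mem_sdiff, ha, Finset.mem_singleton]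
  have hb' : ∀ x, (x ∈ t ∧ x ∉ s) ↔ x = b := fun x => by
    rw [← Finset.mem_sdiff, hb, Finset.mem_singleton]
  have hlim : ∀ {r : Finset (Space d)} {R : Fin d → MvPolynomial (Fin d) ℝ},
      r ∈ 𝒯.phaseElements ω → Set.EqOn u (polyField R) (openSimplex r) →
      ∀ x ∈ closedSimplex r, x ∈ 𝒯.extendedDomain ω → u x = polyField R x := by
    intro r R hr hR x hxr hx
    have hcl : x ∈ closure (openSimplex r) := by
      rw [openSimplex, (convex_closedSimplex r).closure_interior_eq_closure_of_nonempty_interior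
        (openSimplex_nonempty hr)]
      exact subset_closure hxr
    have := mem_closure_iff_nhdsWithin_neBot.1 hcl
    have h1 : Tendsto u (𝓝[openSimplex r] x) (𝓝 (u x)) :=
      (hu.1.continuousAt (isOpen_interior.mem_nhds hx)).tendsto.mono_left nhdsWithin_le_nhds
    have h2 : Tendsto u (𝓝[openSimplex r] x) (𝓝 (polyField R x)) :=
      (((polyField_continuous R).tendsto x).mono_left nhdsWithin_le_nhds).congr'
        (by filter_upwards [self_mem_nhdsWithin] with y hy using (hR hy).symm)
    exact tendsto_nhds_unique h1 h2
  have hclosed : IsClosed {x | polyField P x = polyField Q x} :=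
    isClosed_eq (polyField_continuous P) (polyField_continuous Q)
  -- A vertex may lie on the boundary of the extended domain, where `u` need not be continuous.
  -- Agreement is therefore shown in the relative interior of the facet, which is interior to `s ∪
  -- t`, and extended by closedness.
  refine closure_minimal ?_ hclosed (mem_closure_relInterior hv)
  rintro x ⟨w, hw, hw1, rfl⟩
  have hxe : ∑ y ∈ s ∩ t, w y • y ∈ closedSimplex (s ∩ t) := by
    rw [closedSimplex, Finset.mem_convexHull']
    exact ⟨w, fun v hv => (hw v hv).le, hw1, rfl⟩
  have hint : ∑ y ∈ s ∩ t, w y • y ∈ 𝒯.extendedDomain ω := by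
    refine interior_mono (Set.union_subset
      (Set.subset_biUnion_of_mem (u := fun s => closedSimplex s) hs)
      (Set.subset_biUnion_of_mem (u := fun s => closedSimplex s) ht))
      (mem_interior_union_of_pos hsc (affineIndependent_of_mem_elements hs') htc
        (affineIndependent_of_mem_elements ht') Finset.inter_subset_left
        Finset.inter_subset_right ((ha' a).2 rfl).1 ((hb' b).2 rfl).1
        (fun h => ((ha' a).2 rfl).2 (Finset.mem_inter.1 h).2)
        (fun h => ((hb' b).2 rfl).2 (Finset.mem_inter.1 h).1) (fun v hv => ?_) (fun v hv => ?_)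
        (closedSimplex_inter_subset hs' ht') hw hw1)
    · rw [← ha', Finset.mem_inter]
      tauto
    · rw [← hb', Finset.mem_inter]
      tauto
  exact (hlim hs hP _ (closedSimplex_mono Finset.inter_subset_left hxe) hint).symm.trans
    (hlim ht hQ _ (closedSimplex_mono Finset.inter_subset_right hxe) hint)

/-! ### The elementwise energy -/

theorem symGradNormSq_nonneg (u : Space d → Space d) (S : Set (Space d)) :
    0 ≤ symGradNormSq u S :=
  integral_nonneg fun _ => Finset.sum_nonneg fun _ _ => Finset.sum_nonneg fun _ _ => sq_nonneg _

theorem continuous_symGrad_polyField_sq (P : Fin d → MvPolynomial (Fin d) ℝ) :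
    Continuous fun x => ∑ i, ∑ j, symGrad (polyField P) x i j ^ 2 :=
  continuous_finsetSum _ fun i _ => continuous_finsetSum _ fun j _ =>
    (symGrad_polyField_continuous P i j).pow 2

theorem symGradNormSq_polyField_mono {P : Fin d → MvPolynomial (Fin d) ℝ} {S U : Set (Space d)}
    (hSU : S ⊆ U) (hU : Bornology.IsBounded U) :
    symGradNormSq (polyField P) S ≤ symGradNormSq (polyField P) U := by
  refine setIntegral_mono_set ?_ (Eventually.of_forall fun _ => Finset.sum_nonneg fun _ _ =>
    Finset.sum_nonneg fun _ _ => sq_nonneg _) hSU.eventuallyLE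
  exact ((continuous_symGrad_polyField_sq P).continuousOn.integrableOn_compact
    hU.isCompact_closure).mono_set subset_closure

theorem symGradNormSq_congr {u v : Space d → Space d} {U : Set (Space d)} (hU : IsOpen U)
    (h : Set.EqOn u v U) : symGradNormSq u U = symGradNormSq v U :=
  setIntegral_congr_fun hU.measurableSet fun x hx => by simp only [symGrad_congr hU h hx]

/-- The open elements are disjoint subsets of the extended domain. Monotonicity needs integrability
on all of it; the element boundaries, where `u` may fail to be differentiable, are null sets. -/
theorem sum_symGradNormSq_le {m : ℕ} {u : Space d → Space d} (hu : u ∈ 𝒯.velocitySpace ω m) :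
    ∑ s ∈ 𝒯.phaseElements ω, symGradNormSq u (openSimplex s) ≤
      symGradNormSq u (𝒯.extendedDomain ω) := by
  have hint : ∀ s ∈ 𝒯.phaseElements ω,
      IntegrableOn (fun x => ∑ i, ∑ j, symGrad u x i j ^ 2) (openSimplex s) := fun s hs => by
    obtain ⟨P, -, hP⟩ := hu.2 s hs
    refine IntegrableOn.congr_fun (f := fun x => ∑ i, ∑ j, symGrad (polyField P) x i j ^ 2) ?_
      (fun x hx => by simp only [symGrad_congr isOpen_interior hP hx])
      isOpen_interior.measurableSet
    exact ((continuous_symGrad_polyField_sq P).continuousOn.integrableOn_compact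
      (isCompact_closedSimplex s)).mono_set interior_subset
  have hint' : IntegrableOn (fun x => ∑ i, ∑ j, symGrad u x i j ^ 2)
      (𝒯.extendedDomain ω) := by
    refine ((integrableOn_finset_iUnion (s := 𝒯.phaseElements ω)
      (t := fun s => closedSimplex s)).2 fun s hs => ?_).mono_set interior_subset
    exact (hint s hs).congr_set_ae (closedSimplex_ae_eq_openSimplex s)
  unfold symGradNormSq
  rw [← integral_biUnion_finset (s := openSimplex) _ (fun s _ => isOpen_interior.measurableSet)
    (fun s hs t ht hst => disjoint_openSimplex (𝒯.mem_phaseElements.1 hs).1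
      (𝒯.mem_phaseElements.1 ht).1 hst) hint]
  exact setIntegral_mono_set hint' (Eventually.of_forall fun _ => Finset.sum_nonneg fun _ _ =>
    Finset.sum_nonneg fun _ _ => sq_nonneg _)
    (Set.iUnion₂_subset fun s hs => openSimplex_subset_extendedDomain hs).eventuallyLE

end Triangulation

/-! ### Jump estimates near a facet -/

/-- For `d ≥ 2` a facet has two distinct vertices. With shape regularity this makes `r`, the facet
diameter and the element diameter comparable. -/
theorem two_mul_le_simplexDiam_of_closedBall_subset (hd : 2 ≤ d) {s e : Finset (Space d)}
    (hs : s.card = d + 1) (hsi : AffineIndependent ℝ ((↑) : s → Space d)) (hes : e ⊆ s)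
    (he : e.card = d) {x₀ : Space d} {r : ℝ} (hr : 0 < r)
    (hB : closedBall x₀ r ⊆ closedSimplex s) : 2 * r ≤ simplexDiam e := by
  obtain ⟨p, hp, q, hq, hpq⟩ := Finset.one_lt_card.1 (show 1 < e.card by omega)
  exact (two_mul_le_norm_sub_of_closedBall_subset hr hB hs hsi (hes hp) (hes hq) hpq).trans
    (norm_sub_le_simplexDiam (subset_closedSimplex e hp) (subset_closedSimplex e hq))

/-- Korn's inequality on an element, near one of its facets, modulo rigid motions. -/
theorem exists_korn_near_facet (hd : 2 ≤ d) (m : ℕ) {σ : ℝ} (hσ : 1 ≤ σ) : ∃ C : ℝ, 0 ≤ C ∧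
    ∀ {s e : Finset (Space d)}, s.card = d + 1 →
      AffineIndependent ℝ ((↑) : s → Space d) → e ⊆ s → e.card = d →
      ∀ {x₀ : Space d} {r : ℝ}, 0 < r → closedBall x₀ r ⊆ closedSimplex s →
      simplexDiam s ≤ σ * (2 * r) →
      ∀ {P : Fin d → MvPolynomial (Fin d) ℝ}, (∀ i, (P i).totalDegree ≤ m) →
      ∃ ρ : Space d → Space d, IsRigid ρ ∧ ∀ c ∈ e, ∀ x, ‖x - c‖ ≤ σ * simplexDiam e →
        ‖polyField P x - ρ x‖ ^ 2 ≤ C * (simplexDiam e ^ 2 * (simplexDiam e ^ d)⁻¹ *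
          symGradNormSq (polyField P) (openSimplex s)) := by
  -- The radius comes from `‖x - x₀‖ ≤ σ * h + 2 * σ * r` and `h ≤ 2 * σ * r`; the factor `(2 * σ) ^
  -- d` below trades `(r ^ d)⁻¹` for `(h ^ d)⁻¹`.
  obtain ⟨C, hC, hK⟩ := exists_korn_ball d m (2 * σ ^ 2 + 2 * σ)
  refine ⟨C * (2 * σ) ^ d, by positivity, ?_⟩
  intro s e hs hsi hes he x₀ r hr hB hdiam P hP
  obtain ⟨ρ, hρ, hb⟩ := hK P hP x₀ r hr
  refine ⟨ρ, hρ, fun c hc x hx => ?_⟩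
  set h := simplexDiam e with hh
  have hrh : 2 * r ≤ h := two_mul_le_simplexDiam_of_closedBall_subset hd hs hsi hes he hr hB
  have hhr : h ≤ σ * (2 * r) := (simplexDiam_mono hes).trans hdiam
  have hh0 : 0 < h := by linarith
  have hcx : ‖c - x₀‖ ≤ σ * (2 * r) := (norm_sub_le_simplexDiam
    (subset_closedSimplex s (hes hc)) (hB (mem_closedBall_self hr.le))).trans hdiam
  refine (hb x ?_).trans ?_
  · rw [mem_closedBall, dist_eq_norm, ← sub_add_sub_cancel x c x₀]
    refine (norm_add_le _ _).trans ?_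
    have : σ * h ≤ σ * (σ * (2 * r)) := by gcongr
    nlinarith
  · have hE : symGradNormSq (polyField P) (ball x₀ r) ≤
        symGradNormSq (polyField P) (openSimplex s) := by
      refine Triangulation.symGradNormSq_polyField_mono ?_
        ((isCompact_closedSimplex s).isBounded.subset interior_subset)
      exact interior_maximal (ball_subset_closedBall.trans hB) isOpen_ball
    have h1 : (r ^ d)⁻¹ ≤ (2 * σ) ^ d * (h ^ d)⁻¹ := by
      rw [← div_eq_mul_inv, ← div_pow, ← inv_pow]
      gcongr
      rw [inv_le_iff_one_le_mul₀ hr, div_mul_eq_mul_div, le_div_iff₀ hh0]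
      linarith
    have h2 : r ^ 2 ≤ h ^ 2 := by gcongr; linarith
    calc C * (r ^ 2 * (r ^ d)⁻¹ * symGradNormSq (polyField P) (ball x₀ r))
        ≤ C * (h ^ 2 * ((2 * σ) ^ d * (h ^ d)⁻¹) *
          symGradNormSq (polyField P) (openSimplex s)) := by
          gcongr
          exact Triangulation.symGradNormSq_nonneg _ _
      _ = _ := by ring

theorem exists_norm_sub_sq_le_near_facet (hd : 2 ≤ d) (m : ℕ) {σ : ℝ} (hσ : 1 ≤ σ) :
    ∃ C : ℝ, 0 ≤ C ∧ ∀ {s t e : Finset (Space d)}, s.card = d + 1 →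
      AffineIndependent ℝ ((↑) : s → Space d) → e ⊆ s → t.card = d + 1 →
      AffineIndependent ℝ ((↑) : t → Space d) → e ⊆ t → e.card = d →
      ∀ {x₁ x₂ : Space d} {r₁ r₂ : ℝ}, 0 < r₁ → closedBall x₁ r₁ ⊆ closedSimplex s →
      simplexDiam s ≤ σ * (2 * r₁) → 0 < r₂ → closedBall x₂ r₂ ⊆ closedSimplex t →
      simplexDiam t ≤ σ * (2 * r₂) →
      ∀ {P Q : Fin d → MvPolynomial (Fin d) ℝ}, (∀ i, (P i).totalDegree ≤ m) →
      (∀ i, (Q i).totalDegree ≤ m) → (∀ v ∈ e, polyField P v = polyField Q v) →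
      ∀ c ∈ e, ∀ x, ‖x - c‖ ≤ σ * simplexDiam e →
        ‖polyField P x - polyField Q x‖ ^ 2 ≤ C * (simplexDiam e ^ 2 * (simplexDiam e ^ d)⁻¹ *
          (symGradNormSq (polyField P) (openSimplex s) +
            symGradNormSq (polyField Q) (openSimplex t))) := by
  obtain ⟨C, hC, hK⟩ := exists_korn_near_facet hd m hσ
  -- `K - 1` is the factor that `IsRigid.norm_le` gives for `ρ - τ`; the remaining `1` pays for `P -
  -- ρ` and `Q - τ`.
  set K : ℝ := 2 + (d + 1) * σ ^ 2 * (2 + 2 * (d + 1) * σ) with hKdef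
  have hK0 : 0 ≤ K := by positivity
  refine ⟨K ^ 2 * (2 * C), by positivity, ?_⟩
  intro s t e hs hsi hes ht hti het he x₁ x₂ r₁ r₂ hr₁ hB₁ hd₁ hr₂ hB₂ hd₂ P Q hP hQ hPQ c hc x hx
  obtain ⟨ρ, hρ, hPρ⟩ := hK hs hsi hes he hr₁ hB₁ hd₁ hP
  obtain ⟨τ, hτ, hQτ⟩ := hK ht hti het he hr₂ hB₂ hd₂ hQ
  set h := simplexDiam e with hh
  have hrh : 2 * r₁ ≤ h := two_mul_le_simplexDiam_of_closedBall_subset hd hs hsi hes he hr₁ hB₁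
  have hhr : h ≤ σ * (2 * r₁) := (simplexDiam_mono hes).trans hd₁
  have hh0 : 0 < h := by linarith
  set A := C * (h ^ 2 * (h ^ d)⁻¹ * symGradNormSq (polyField P) (openSimplex s)) with hA
  set B := C * (h ^ 2 * (h ^ d)⁻¹ * symGradNormSq (polyField Q) (openSimplex t)) with hBd
  have hA0 : 0 ≤ A := (sq_nonneg _).trans (hPρ c hc x hx)
  have hB0 : 0 ≤ B := (sq_nonneg _).trans (hQτ c hc x hx)
  set δ := √A + √B with hδ
  have hδ0 : 0 ≤ δ := by positivity
  have hδsq : δ ^ 2 ≤ 2 * (A + B) := by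
    have := Real.sq_sqrt hA0
    have := Real.sq_sqrt hB0
    nlinarith [sq_nonneg (√A - √B)]
  have hsum : ∀ y, ‖y - c‖ ≤ σ * h → ‖polyField P y - ρ y‖ + ‖polyField Q y - τ y‖ ≤ δ :=
    fun y hy => add_le_add (Real.le_sqrt_of_sq_le (hPρ c hc y hy))
      (Real.le_sqrt_of_sq_le (hQτ c hc y hy))
  have hvert : ∀ v ∈ e, ‖(ρ - τ) v‖ ≤ δ := fun v hv => by
    have h1 : (ρ - τ) v = (polyField Q v - τ v) - (polyField P v - ρ v) := by
      rw [hPQ v hv, Pi.sub_apply]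
      abel
    have h2 : ‖v - c‖ ≤ σ * h := (norm_sub_le_simplexDiam (subset_closedSimplex e hv)
      (subset_closedSimplex e hc)).trans (le_mul_of_one_le_left hh0.le hσ)
    rw [h1]
    refine (norm_sub_le _ _).trans ?_
    linarith [hsum v h2]
  obtain ⟨a, has, hae⟩ : ∃ a ∈ s, a ∉ e := by
    by_contra! hsub
    have := Finset.card_le_card (show s ⊆ e from hsub)
    omega
  have hse : ∀ v ∈ s, v = a ∨ v ∈ e := fun v hv => by
    classical
    by_contra! hcon
    have h1 : insert v (insert a e) ⊆ s :=
      Finset.insert_subset hv (Finset.insert_subset has hes)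
    have h2 := Finset.card_le_card h1
    rw [Finset.card_insert_of_notMem (by simp [hcon.1, hcon.2]),
      Finset.card_insert_of_notMem hae] at h2
    omega
  have hac : ‖a - c‖ ≤ σ * (2 * r₁) := (norm_sub_le_simplexDiam (subset_closedSimplex s has)
    (subset_closedSimplex s (hes hc))).trans hd₁
  have hrig := (hρ.sub hτ).norm_le hr₁ hB₁ has hse hc hac hvert x
  have hxc : ‖x - c‖ ≤ σ * (σ * (2 * r₁)) := hx.trans (by gcongr)
  have hrig' : ‖(ρ - τ) x‖ ≤ (K - 1) * δ := by
    refine hrig.trans ?_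
    rw [hs]
    push_cast
    calc δ + (d + 1) / (2 * r₁) * (‖x - c‖ * (2 * δ + (d + 1) / r₁ * (δ * (σ * (2 * r₁)))))
        ≤ δ + (d + 1) / (2 * r₁) *
          (σ * (σ * (2 * r₁)) * (2 * δ + (d + 1) / r₁ * (δ * (σ * (2 * r₁))))) := by gcongr
      _ = (K - 1) * δ := by
        rw [hKdef]
        field_simp
        ring
  have hmain : ‖polyField P x - polyField Q x‖ ≤ K * δ := by
    have h1 : polyField P x - polyField Q x =
        (polyField P x - ρ x) - (polyField Q x - τ x) + (ρ - τ) x := by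
      rw [Pi.sub_apply]
      abel
    rw [h1]
    refine (norm_add_le _ _).trans ?_
    linarith [norm_sub_le (polyField P x - ρ x) (polyField Q x - τ x), hsum x hx]
  calc ‖polyField P x - polyField Q x‖ ^ 2 ≤ (K * δ) ^ 2 := by gcongr
    _ = K ^ 2 * δ ^ 2 := by ring
    _ ≤ K ^ 2 * (2 * (A + B)) := by gcongr
    _ = _ := by
      rw [hA, hBd]
      ring

/-! ### Integration over patches and summation over ghost facets -/

namespace Triangulation

variable {𝒯 : Triangulation Ω} {ω Γ : Set (Space d)} {e : Finset (Space d)}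

theorem extJump_eq (u : Space d → Space d)
    (he : e ∈ 𝒯.ghostFacets ω Γ) : ∃ s t, 𝒯.IsGhostFacet ω Γ e s t ∧
      𝒯.extJump ω Γ e u = fun x => canonicalExt u s x - canonicalExt u t x := by
  classical
  have h : ∃ T : Finset (Space d) × Finset (Space d), 𝒯.IsGhostFacet ω Γ e T.1 T.2 := by
    obtain ⟨s, t, hst⟩ := (Finset.mem_filter.1 he).2
    exact ⟨(s, t), hst⟩
  refine ⟨h.choose.1, h.choose.2, h.choose_spec, ?_⟩
  funext x
  rw [extJump, dif_pos h]

theorem patch_subset_closedBall (hd : 2 ≤ d) {σ : ℝ} (hσ : 1 ≤ σ) (h𝒯 : 𝒯.ShapeRegular σ)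
    (he : e.card = d) {c : Space d} (hc : c ∈ e) :
    𝒯.patch e ⊆ closedBall c (σ * simplexDiam e) := by
  refine Set.iUnion₂_subset fun s hs x hx => ?_
  obtain ⟨hs, hes⟩ : s ∈ 𝒯.elements ∧ e ⊆ s := hs
  obtain ⟨x₀, r, hr, hB, hdiam⟩ := h𝒯 s hs
  rw [mem_closedBall, dist_eq_norm]
  have h1 := two_mul_le_simplexDiam_of_closedBall_subset hd (𝒯.mem_elements.1 hs).2
    (affineIndependent_of_mem_elements hs) hes he hr hB
  calc ‖x - c‖ ≤ σ * (2 * r) :=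
        (norm_sub_le_simplexDiam hx (subset_closedSimplex s (hes hc))).trans hdiam
    _ ≤ σ * simplexDiam e := by gcongr

theorem exists_patch_integral_le (hd : 2 ≤ d) (m : ℕ) {σ : ℝ} (hσ : 1 ≤ σ) :
    ∃ C : ℝ, 0 ≤ C ∧ ∀ {Ω : Set (Space d)} {𝒯 : Triangulation Ω}, 𝒯.ShapeRegular σ →
      ∀ {ω Γ : Set (Space d)} {u : Space d → Space d}, u ∈ 𝒯.velocitySpace ω m →
      ∀ e ∈ 𝒯.ghostFacets ω Γ, ∃ s ∈ 𝒯.phaseElements ω, ∃ t ∈ 𝒯.phaseElements ω,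
        s ≠ t ∧ e ⊆ s ∧ e ⊆ t ∧ e.card = d ∧
        1 / simplexDiam e ^ 2 *
          ∫ x in 𝒯.patch e, inner ℝ (𝒯.extJump ω Γ e u x) (𝒯.extJump ω Γ e u x) ≤
        C * (symGradNormSq u (openSimplex s) + symGradNormSq u (openSimplex t)) := by
  obtain ⟨C, hC, hK⟩ := exists_norm_sub_sq_le_near_facet hd m hσ
  -- All powers of `h` cancel: `h⁻²` from the form, `h ^ 2 * (h ^ d)⁻¹` from the pointwise bound,
  -- and `(σ * h) ^ d` from a ball containing the patch.
  refine ⟨C * (σ ^ d * volume.real (ball (0 : Space d) 1)), by positivity, ?_⟩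
  intro Ω 𝒯 h𝒯 ω Γ u hu e he
  obtain ⟨s, t, hst, hJ⟩ := extJump_eq u he
  obtain ⟨hs, ht, hne, hest, hcard, -⟩ := hst
  obtain ⟨P, hPm, hP⟩ := hu.2 s hs
  obtain ⟨Q, hQm, hQ⟩ := hu.2 t ht
  have hs' := (𝒯.mem_phaseElements.1 hs).1
  have ht' := (𝒯.mem_phaseElements.1 ht).1
  obtain ⟨x₁, r₁, hr₁, hB₁, hd₁⟩ := h𝒯 s hs'
  obtain ⟨x₂, r₂, hr₂, hB₂, hd₂⟩ := h𝒯 t ht'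
  have hes : e ⊆ s := by rw [hest]; exact Finset.inter_subset_left
  have het : e ⊆ t := by rw [hest]; exact Finset.inter_subset_right
  refine ⟨s, hs, t, ht, hne, hes, het, hcard, ?_⟩
  obtain ⟨c, hc⟩ : e.Nonempty := Finset.card_pos.1 (by omega)
  have hh0 : 0 < simplexDiam e := by
    have := two_mul_le_simplexDiam_of_closedBall_subset hd (𝒯.mem_elements.1 hs').2
      (affineIndependent_of_mem_elements hs') hes hcard hr₁ hB₁
    linarith
  rw [hJ, canonicalExt_eq (openSimplex_nonempty hs) hP,
    canonicalExt_eq (openSimplex_nonempty ht) hQ,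
    symGradNormSq_congr (U := openSimplex s) isOpen_interior hP,
    symGradNormSq_congr (U := openSimplex t) isOpen_interior hQ]
  have hagree : ∀ v ∈ e, polyField P v = polyField Q v := fun v hv =>
    polyField_eq_on_facet hu hs ht (hest ▸ hcard) hP hQ (hest ▸ hv)
  have hpt := hK (𝒯.mem_elements.1 hs').2 (affineIndependent_of_mem_elements hs') hes
    (𝒯.mem_elements.1 ht').2 (affineIndependent_of_mem_elements ht') het hcard hr₁ hB₁ hd₁
    hr₂ hB₂ hd₂ hPm hQm hagree c hc
  set h := simplexDiam e with hh
  set E := symGradNormSq (polyField P) (openSimplex s) +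
    symGradNormSq (polyField Q) (openSimplex t) with hE
  have hE0 : 0 ≤ E := add_nonneg (symGradNormSq_nonneg _ _) (symGradNormSq_nonneg _ _)
  have hsub := patch_subset_closedBall hd hσ h𝒯 hcard hc
  have hvol : volume.real (𝒯.patch e) ≤ (σ * h) ^ d * volume.real (ball (0 : Space d) 1) := by
    refine (measureReal_mono hsub measure_closedBall_lt_top.ne).trans_eq ?_
    rw [Measure.addHaar_real_closedBall _ _ (by positivity), finrank_euclideanSpace_fin]
  have hint := norm_setIntegral_le_of_norm_le_const (μ := volume)
    (f := fun x => inner ℝ (polyField P x - polyField Q x) (polyField P x - polyField Q x))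
    (C := C * (h ^ 2 * (h ^ d)⁻¹ * E))
    ((measure_mono hsub).trans_lt measure_closedBall_lt_top) (fun x hx => by
      rw [real_inner_self_eq_norm_sq, Real.norm_of_nonneg (sq_nonneg _)]
      refine hpt x ?_
      rw [← dist_eq_norm]
      exact hsub hx)
  calc _ ≤ 1 / h ^ 2 * (C * (h ^ 2 * (h ^ d)⁻¹ * E) *
        ((σ * h) ^ d * volume.real (ball (0 : Space d) 1))) := by
        gcongr
        exact (le_abs_self _).trans (hint.trans (by gcongr))
    _ = _ := by
        rw [mul_pow]
        field_simp

open Classical in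
/-- Every element has at most `d + 1` facets. -/
theorem sum_facets_sum_phaseElements_le {F : Finset (Finset (Space d))}
    (hF : ∀ e ∈ F, e.card = d) {f : Finset (Space d) → ℝ} (hf : ∀ s, 0 ≤ f s) :
    ∑ e ∈ F, ∑ s ∈ (𝒯.phaseElements ω).filter (fun s => e ⊆ s), f s ≤
      (d + 1) * ∑ s ∈ 𝒯.phaseElements ω, f s := by
  simp_rw [Finset.sum_filter]
  rw [Finset.sum_comm, Finset.mul_sum]
  refine Finset.sum_le_sum fun s hs => ?_
  rw [← Finset.sum_filter, Finset.sum_const, nsmul_eq_mul]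
  refine mul_le_mul_of_nonneg_right ?_ (hf s)
  have hsub : F.filter (fun e => e ⊆ s) ⊆ s.powersetCard d := fun e he => by
    rw [Finset.mem_filter] at he
    exact Finset.mem_powersetCard.2 ⟨he.2, hF e he.1⟩
  have h1 := Finset.card_le_card hsub
  rw [Finset.card_powersetCard, (𝒯.mem_elements.1 (𝒯.mem_phaseElements.1 hs).1).2,
    Nat.choose_succ_self_right] at h1
  exact_mod_cast h1

/-- The ghost penalty form of one phase is bounded by the energy on the extended domain. -/
theorem exists_ghostForm_le (hd : 2 ≤ d) (m : ℕ) {σ : ℝ} (hσ : 1 ≤ σ) (γ : ℝ) :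
    ∃ C : ℝ, 0 ≤ C ∧ ∀ {Ω : Set (Space d)} {𝒯 : Triangulation Ω}, 𝒯.ShapeRegular σ →
      ∀ {ω Γ : Set (Space d)} {u : Space d → Space d}, u ∈ 𝒯.velocitySpace ω m →
        𝒯.ghostForm ω Γ γ u u ≤ C * symGradNormSq u (𝒯.extendedDomain ω) := by
  classical
  obtain ⟨C, hC, h⟩ := exists_patch_integral_le hd m hσ
  refine ⟨|γ| * (C * (d + 1)), by positivity, ?_⟩
  intro Ω 𝒯 h𝒯 ω Γ u hu
  have hloc := fun e he => h h𝒯 (Γ := Γ) hu e he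
  have hsum : ∑ e ∈ 𝒯.ghostFacets ω Γ, 1 / simplexDiam e ^ 2 *
      ∫ x in 𝒯.patch e, inner ℝ (𝒯.extJump ω Γ e u x) (𝒯.extJump ω Γ e u x) ≤
      C * (d + 1) * symGradNormSq u (𝒯.extendedDomain ω) := by
    calc _ ≤ ∑ e ∈ 𝒯.ghostFacets ω Γ, C * ∑ s ∈ (𝒯.phaseElements ω).filter (fun s => e ⊆ s),
          symGradNormSq u (openSimplex s) := Finset.sum_le_sum fun e he => by
            obtain ⟨s, hs, t, ht, hne, hes, het, -, hle⟩ := hloc e he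
            refine hle.trans (mul_le_mul_of_nonneg_left ?_ hC)
            rw [← Finset.sum_pair hne (f := fun s => symGradNormSq u (openSimplex s))]
            refine Finset.sum_le_sum_of_subset_of_nonneg ?_ fun _ _ _ => symGradNormSq_nonneg _ _
            intro r hr
            rcases Finset.mem_insert.1 hr with rfl | hr
            · exact Finset.mem_filter.2 ⟨hs, hes⟩
            · rw [Finset.mem_singleton.1 hr]
              exact Finset.mem_filter.2 ⟨ht, het⟩
      _ ≤ C * ((d + 1) * ∑ s ∈ 𝒯.phaseElements ω, symGradNormSq u (openSimplex s)) := by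
            rw [← Finset.mul_sum]
            refine mul_le_mul_of_nonneg_left ?_ hC
            exact sum_facets_sum_phaseElements_le (fun e he => by
              obtain ⟨s, -, t, -, -, -, -, hcard, -⟩ := hloc e he
              exact hcard) fun _ => symGradNormSq_nonneg _ _
      _ ≤ _ := by
            rw [← mul_assoc]
            exact mul_le_mul_of_nonneg_left (sum_symGradNormSq_le hu) (by positivity)
  -- Nonnegativity of the sum allows `γ` of either sign to be replaced by `|γ|`.
  have hsum0 : 0 ≤ ∑ e ∈ 𝒯.ghostFacets ω Γ, 1 / simplexDiam e ^ 2 *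
      ∫ x in 𝒯.patch e, inner ℝ (𝒯.extJump ω Γ e u x) (𝒯.extJump ω Γ e u x) :=
    Finset.sum_nonneg fun e _ => mul_nonneg (by positivity)
      (integral_nonneg fun x => real_inner_self_nonneg)
  calc 𝒯.ghostForm ω Γ γ u u ≤ |γ| * _ := mul_le_mul_of_nonneg_right (le_abs_self γ) hsum0
    _ ≤ |γ| * (C * (d + 1) * symGradNormSq u (𝒯.extendedDomain ω)) := by gcongr
    _ = _ := by ring

theorem ShapeRegular.mono {σ σ' : ℝ} (h : 𝒯.ShapeRegular σ) (hσ : σ ≤ σ') :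
    𝒯.ShapeRegular σ' := fun s hs => by
  obtain ⟨x, r, hr, hB, hd⟩ := h s hs
  exact ⟨x, r, hr, hB, hd.trans (by gcongr)⟩

end Triangulation

end TwoPhaseStokes

end

open TwoPhaseStokes in
theorem lemma3 (d : ℕ) (hd : d = 2 ∨ d = 3) (k : ℕ) (hk : 1 ≤ k) (σ γm γp : ℝ) :
    ∃ C : ℝ, 0 < C ∧
      ∀ (Ω : Set (Space d)) (_ : IsOpen Ω)
        (𝒯 : Triangulation Ω) (_ : 𝒯.ShapeRegular σ)
        (Ωm : Set (Space d)) (_ : IsOpen Ωm) (_ : closure Ωm ⊆ Ω)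
        (μm μp : ℝ) (_ : 0 < μm) (_ : 0 < μp),
        ∀ v ∈ 𝒯.twoPhaseVelocitySpace Ωm k,
          𝒯.velocityPenalty Ωm μm μp γm γp v v ≤
            C * (μm * symGradNormSq v.1 (𝒯.extendedDomain Ωm) +
              μp * symGradNormSq v.2 (𝒯.extendedDomain (outerPhase Ω Ωm))) := by
  have hd' : 2 ≤ d := by omega
  -- The local estimates assume `1 ≤ σ`; enlarging the constant keeps shape regularity.
  have hσ : 1 ≤ max σ 1 := le_max_right _ _
  obtain ⟨C₁, hC₁, h₁⟩ := Triangulation.exists_ghostForm_le hd' (k + 1) hσ γm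
  obtain ⟨C₂, hC₂, h₂⟩ := Triangulation.exists_ghostForm_le hd' (k + 1) hσ γp
  -- One constant dominates both phases, and the `1` makes it strictly positive.
  refine ⟨C₁ + C₂ + 1, by positivity, ?_⟩
  intro Ω _ 𝒯 h𝒯 Ωm _ _ μm μp hμm hμp v hv
  have h𝒯' := h𝒯.mono (le_max_left σ 1)
  have hA := Triangulation.symGradNormSq_nonneg v.1 (𝒯.extendedDomain Ωm)
  have hB := Triangulation.symGradNormSq_nonneg v.2 (𝒯.extendedDomain (outerPhase Ω Ωm))
  have hm : 𝒯.ghostForm Ωm (interface Ωm) γm v.1 v.1 ≤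
      (C₁ + C₂ + 1) * symGradNormSq v.1 (𝒯.extendedDomain Ωm) :=
    (h₁ h𝒯' hv.1).trans (mul_le_mul_of_nonneg_right (by linarith) hA)
  have hp : 𝒯.ghostForm (outerPhase Ω Ωm) (interface Ωm) γp v.2 v.2 ≤
      (C₁ + C₂ + 1) * symGradNormSq v.2 (𝒯.extendedDomain (outerPhase Ω Ωm)) :=
    (h₂ h𝒯' hv.2).trans (mul_le_mul_of_nonneg_right (by linarith) hB)
  calc 𝒯.velocityPenalty Ωm μm μp γm γp v v
      ≤ μm * ((C₁ + C₂ + 1) * symGradNormSq v.1 (𝒯.extendedDomain Ωm)) +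
        μp * ((C₁ + C₂ + 1) * symGradNormSq v.2 (𝒯.extendedDomain (outerPhase Ω Ωm))) :=
        add_le_add (mul_le_mul_of_nonneg_left hm hμm.le) (mul_le_mul_of_nonneg_left hp hμp.le)
    _ = _ := by ring
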